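/- For a compact convex set $K\subset\mathbb{R}^n$ let $h_K(u)=\sup\{\langle u,y\rangle : y\in K\}$ be its support function, and define its mean width by $$w(K)=\int_{\mathbb{S}^{n-1}} h_K(u)\,d\sigma(u),$$ where $\sigma$ is the rotationally invariant probability measure on the unit sphere $\mathbb{S}^{n-1}$. Let $T^n\subset\mathbb{R}^n$ be any $n$-dimensional regular simplex of unit edge length, i.e. the convex hull of $n+1$ affinely independent points with all mutual distances equal to $1$. Then \begin{align*} 0.4208 \le {} & w(T^5) \le 0.4215, \\ 0.4067 \le {} & w(T^6) \le 0.407, \\ 0.39425 \le {} & w(T^7) \le 0.39427, \\ 0.383 \le {} & w(T^8) \le 0.38301. \end{align*} -/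

import Mathlib

open MeasureTheory

noncomputable section

/-- The support function `h_K(u) = sup {⟪u, y⟫ : y ∈ K}` of a set `K` in a Euclidean space. -/
def supportFn {n : ℕ} (K : Set (EuclideanSpace ℝ (Fin n))) (u : EuclideanSpace ℝ (Fin n)) : ℝ :=
  sSup ((fun y => inner ℝ u y) '' K)

/-- The rotationally invariant probability measure on the unit sphere of `ℝⁿ` (for `n ≥ 1`):
the surface measure divided by its total mass. -/
def sphereProb (n : ℕ) : Measure (Metric.sphere (0 : EuclideanSpace ℝ (Fin n)) 1) :=
  ((volume : Measure (EuclideanSpace ℝ (Fin n))).toSphere Set.univ)⁻¹ •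
    (volume : Measure (EuclideanSpace ℝ (Fin n))).toSphere

/-- The mean width `w(K) = ∫ h_K(u) dσ(u)` over the unit sphere, in the normalization in which it
is the mean of the support function (so that the unit ball has mean width `1`). -/
def meanWidth {n : ℕ} (K : Set (EuclideanSpace ℝ (Fin n))) : ℝ :=
  ∫ u : Metric.sphere (0 : EuclideanSpace ℝ (Fin n)) 1,
    supportFn K (u : EuclideanSpace ℝ (Fin n)) ∂(sphereProb n)

/-- `T` is an `n`-dimensional regular simplex of unit edge length in `ℝⁿ`: the convex hull of
`n + 1` affinely independent points with all mutual distances equal to `1`. -/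
def IsUnitRegularSimplex {n : ℕ} (T : Set (EuclideanSpace ℝ (Fin n))) : Prop :=
  ∃ s : Affine.Simplex ℝ (EuclideanSpace ℝ (Fin n)) n,
    (∀ i j, i ≠ j → dist (s.points i) (s.points j) = 1) ∧
      T = convexHull ℝ (Set.range s.points)

end

open ProbabilityTheory Filter Topology

/-! Let `G` be a standard Gaussian vector in dimension `n`. Its norm and its direction are
independent and the support function is homogeneous of degree one, so the expectation of `h_T(G)` is
`w(T)` times the mean of `‖G‖`, a ratio of half-line Gaussian moments
(`integral_supportFn_stdGaussian`). For a simplex, `h_T(G)` is the maximum of the variables `⟪p i,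
G⟫`. Its expectation depends only on the distances between the `p i` (`integral_iSup_inner_congr`),
so the vertices may be replaced by orthonormal vectors divided by `√2`. This leaves the expected
maximum of `n + 1` independent standard normals.

Layer-cake and an integration by parts (`integral_iSup_pi_gaussianReal`,
`integral_one_sub_normal_pow`) turn that expectation into the integral of `exp (-t²) (Φ^m + (1 -
Φ)^m)` with `m = n - 1`. With `Φ = 1/2 + ψ` the odd powers of `ψ` cancel, and for `m ≤ 7` only the
moments of `ψ²`, `ψ⁴`, `ψ⁶` are needed.

These are enclosed through `ψ = φ ∑ x^(2j+1) / (2j+1)‼`, where `φ` is the normal density. Truncation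
gives a lower bound with an explicit error, and the truncated integrals are exact rationals times
Gaussian moments (`le_normalHalfMean`, `normalHalfMean_le`). -/

/-! ### Gaussian integrals in polar coordinates and the mean width. -/

theorem stdGaussian_eq_withDensity (V : Type*) [NormedAddCommGroup V] [InnerProductSpace ℝ V]
    [FiniteDimensional ℝ V] [MeasurableSpace V] [BorelSpace V] :
    stdGaussian V = (volume : Measure V).withDensity (fun x => ENNReal.ofReal
      (((2 * Real.pi) ^ (Module.finrank ℝ V / 2 : ℝ))⁻¹ * Real.exp (-‖x‖ ^ 2 / 2))) := by
  set c : ℝ := ((2 * Real.pi) ^ (Module.finrank ℝ V / 2 : ℝ))⁻¹ with hc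
  have hc0 : 0 ≤ c := by positivity
  have hint : Integrable (fun x : V => c * Real.exp (-‖x‖ ^ 2 / 2)) := by
    have h := (GaussianFourier.integrable_cexp_neg_mul_sq_norm_add (V := V) (b := 1 / 2)
      (by norm_num) 0 0).norm
    refine Integrable.const_mul (h.congr (.of_forall fun x => ?_)) c
    simp only [Complex.norm_exp]
    congr 1
    simp [← Complex.ofReal_pow]
    ring
  have : IsFiniteMeasure ((volume : Measure V).withDensity (fun x => ENNReal.ofReal
      (c * Real.exp (-‖x‖ ^ 2 / 2)))) :=
    isFiniteMeasure_withDensity_ofReal hint.2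
  -- Both are finite measures, so it suffices to match characteristic functions; the Fourier
  -- transform of the Gaussian is known.
  apply Measure.ext_of_charFun
  ext t
  rw [charFun_stdGaussian, charFun_apply, integral_withDensity_eq_integral_toReal_smul
    (by fun_prop) (by simp)]
  have h := GaussianFourier.integral_cexp_neg_mul_sq_norm_add (V := V) (b := 1 / 2)
      (by norm_num) Complex.I t
  have e : ∀ x : V, (ENNReal.ofReal (c * Real.exp (-‖x‖ ^ 2 / 2))).toReal •
      Complex.exp (inner ℝ x t * Complex.I) =
      (c : ℂ) * Complex.exp (-(1 / 2) * ‖x‖ ^ 2 + Complex.I * inner ℝ t x) := by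
    intro x
    rw [ENNReal.toReal_ofReal (by positivity), Complex.real_smul, Complex.exp_add,
      real_inner_comm]
    push_cast
    rw [show (-(1 / 2) * (‖x‖ : ℂ) ^ 2) = -‖x‖ ^ 2 / 2 by ring, mul_assoc,
      mul_comm Complex.I]
  simp_rw [e]
  rw [integral_const_mul, h, ← mul_assoc]
  have h1 : (c : ℂ) * ((Real.pi : ℂ) / (1 / 2)) ^ (Module.finrank ℝ V / 2 : ℂ) = 1 := by
    have h2 : ((Real.pi : ℂ) / (1 / 2)) ^ (Module.finrank ℝ V / 2 : ℂ) =
        (((2 * Real.pi) ^ (Module.finrank ℝ V / 2 : ℝ) : ℝ) : ℂ) := by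
      rw [Complex.ofReal_cpow (by positivity)]
      push_cast
      congr 1
      ring
    rw [h2, ← Complex.ofReal_mul, hc, inv_mul_cancel₀ (by positivity), Complex.ofReal_one]
  rw [h1, one_mul]
  congr 1
  rw [Complex.I_sq]
  ring

/-- Polar coordinates off the origin: homogeneity splits the integrand into a function of direction
times a function of radius, and Fubini gives the product. -/
theorem integral_homogeneous_mul_radial {E : Type*} [NormedAddCommGroup E] [NormedSpace ℝ E]
    [MeasurableSpace E] [Nontrivial E] (μ : Measure E) [FiniteDimensional ℝ E] [BorelSpace E]
    [μ.IsAddHaarMeasure] {f : E → ℝ} (k : ℕ)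
    (hf : ∀ r : ℝ, 0 < r → ∀ x, f (r • x) = r ^ k * f x) (g : ℝ → ℝ) :
    ∫ x, f x * g ‖x‖ ∂μ = (∫ u, f (u : E) ∂μ.toSphere) *
      ∫ r in Set.Ioi (0 : ℝ), r ^ (Module.finrank ℝ E - 1 + k) * g r :=
  calc
    ∫ x, f x * g ‖x‖ ∂μ
      = ∫ x : ({(0)}ᶜ : Set E), f x.1 * g (‖x.1‖) ∂(μ.comap (↑)) := by
      rw [integral_subtype_comap (measurableSet_singleton _).compl fun x ↦ f x * g (‖x‖),
        restrict_compl_singleton]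
    _ = ∫ p, f (p.1 : E) * ((p.2 : ℝ) ^ k * g p.2)
          ∂μ.toSphere.prod (.volumeIoiPow (Module.finrank ℝ E - 1)) := by
      rw [← μ.measurePreserving_homeomorphUnitSphereProd.integral_comp
        (Homeomorph.measurableEmbedding _)]
      refine integral_congr_ae (.of_forall fun x => ?_)
      have hx : (0 : ℝ) < ‖x.1‖ := norm_pos_iff.2 x.2
      simp only [homeomorphUnitSphereProd_apply_snd_coe, homeomorphUnitSphereProd_apply_fst_coe]
      have := hf ‖x.1‖ hx (‖x.1‖⁻¹ • x.1)
      rw [smul_smul, mul_inv_cancel₀ hx.ne', one_smul] at this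
      rw [this]
      ring
    _ = (∫ u, f (u : E) ∂μ.toSphere) * ∫ r : Set.Ioi (0 : ℝ), (r : ℝ) ^ k * g r
          ∂.volumeIoiPow (Module.finrank ℝ E - 1) :=
      integral_prod_mul (fun u : Metric.sphere (0 : E) 1 => f u)
        (fun r : Set.Ioi (0 : ℝ) => (r : ℝ) ^ k * g r)
    _ = _ := by
      congr 1
      simp only [Measure.volumeIoiPow, ENNReal.ofReal]
      rw [integral_withDensity_eq_integral_smul,
        integral_subtype_comap measurableSet_Ioi
          fun a ↦ Real.toNNReal (a ^ (Module.finrank ℝ E - 1)) • (a ^ k * g a),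
        setIntegral_congr_fun measurableSet_Ioi fun x hx ↦ ?_]
      · rw [NNReal.smul_def, Real.coe_toNNReal _ (pow_nonneg hx.out.le _), smul_eq_mul, pow_add,
          mul_assoc]
      · exact (measurable_subtype_coe.pow_const _).real_toNNReal

/-- The half-line Gaussian moment `∫₀^∞ x ^ m * exp (-a x²) dx`. -/
noncomputable def gaussMoment (a : ℝ) (m : ℕ) : ℝ :=
  ∫ x in Set.Ioi (0 : ℝ), x ^ m * Real.exp (-a * x ^ 2)

theorem gaussMoment_eq_Gamma {a : ℝ} (ha : 0 < a) (m : ℕ) :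
    gaussMoment a m = a ^ (-((m : ℝ) + 1) / 2) * (1 / 2) * Real.Gamma (((m : ℝ) + 1) / 2) := by
  have h := integral_rpow_mul_exp_neg_mul_rpow (p := 2) (q := m) (b := a) (by norm_num)
    (by have : (0 : ℝ) ≤ m := by positivity
        linarith) ha
  rw [← h, gaussMoment]
  refine setIntegral_congr_fun measurableSet_Ioi fun x _ => ?_
  simp [Real.rpow_natCast]

theorem gaussMoment_zero {a : ℝ} (ha : 0 < a) :
    gaussMoment a 0 = Real.sqrt Real.pi / Real.sqrt a / 2 := by
  rw [gaussMoment_eq_Gamma ha]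
  have : a ^ (-((0 : ℕ) + 1 : ℝ) / 2) = (Real.sqrt a)⁻¹ := by
    rw [Real.sqrt_eq_rpow, ← Real.rpow_neg ha.le]
    norm_num
  rw [this]
  norm_num [Real.Gamma_one_half_eq]
  ring

theorem gaussMoment_one {a : ℝ} (ha : 0 < a) : gaussMoment a 1 = 1 / (2 * a) := by
  rw [gaussMoment_eq_Gamma ha]
  norm_num [Real.rpow_neg_one]

theorem gaussMoment_add_two {a : ℝ} (ha : 0 < a) (m : ℕ) :
    gaussMoment a (m + 2) = (m + 1) / (2 * a) * gaussMoment a m := by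
  rw [gaussMoment_eq_Gamma ha, gaussMoment_eq_Gamma ha]
  have h1 : (((m + 2 : ℕ) : ℝ) + 1) / 2 = ((m : ℝ) + 1) / 2 + 1 := by push_cast; ring
  have h2 : -(((m + 2 : ℕ) : ℝ) + 1) / 2 = -((m : ℝ) + 1) / 2 - 1 := by push_cast; ring
  rw [h1, h2, Real.Gamma_add_one (by positivity), Real.rpow_sub_one ha.ne']
  field_simp

theorem integrableOn_pow_mul_exp_neg_mul_sq {a : ℝ} (ha : 0 < a) (m : ℕ) :
    IntegrableOn (fun x : ℝ => x ^ m * Real.exp (-a * x ^ 2)) (Set.Ioi 0) := by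
  have h := integrable_rpow_mul_exp_neg_mul_sq ha (s := m)
    (by have : (0 : ℝ) ≤ m := by positivity
        linarith)
  simpa [Real.rpow_natCast] using h.integrableOn

theorem integral_homogeneous_stdGaussian {n : ℕ} (hn : n ≠ 0) {f : EuclideanSpace ℝ (Fin n) → ℝ}
    (k : ℕ) (hf : ∀ r : ℝ, 0 < r → ∀ x, f (r • x) = r ^ k * f x) :
    ∫ x, f x ∂(stdGaussian (EuclideanSpace ℝ (Fin n))) =
      ((2 * Real.pi) ^ (n / 2 : ℝ))⁻¹ *
        (∫ u, f (u : EuclideanSpace ℝ (Fin n))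
          ∂(volume : Measure (EuclideanSpace ℝ (Fin n))).toSphere) *
        gaussMoment (1 / 2) (n - 1 + k) := by
  have : NeZero n := ⟨hn⟩
  rw [stdGaussian_eq_withDensity, integral_withDensity_eq_integral_toReal_smul
    (by fun_prop) (by simp)]
  have e : ∀ x : EuclideanSpace ℝ (Fin n), (ENNReal.ofReal
      (((2 * Real.pi) ^ (Module.finrank ℝ (EuclideanSpace ℝ (Fin n)) / 2 : ℝ))⁻¹ *
        Real.exp (-‖x‖ ^ 2 / 2))).toReal • f x = ((2 * Real.pi) ^ (n / 2 : ℝ))⁻¹ *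
        (f x * (fun r => Real.exp (-(1 / 2) * r ^ 2)) ‖x‖) := by
    intro x
    rw [ENNReal.toReal_ofReal (by positivity), smul_eq_mul, finrank_euclideanSpace_fin]
    simp only
    rw [show -‖x‖ ^ 2 / 2 = -(1 / 2) * ‖x‖ ^ 2 by ring]
    ring
  simp_rw [e]
  rw [integral_const_mul, integral_homogeneous_mul_radial volume k hf
    (fun r => Real.exp (-(1 / 2) * r ^ 2)), gaussMoment, finrank_euclideanSpace_fin, mul_assoc]

/-- Gaussian expectation of the support function in terms of the mean width. -/
theorem integral_supportFn_stdGaussian {n : ℕ} (hn : n ≠ 0) (K : Set (EuclideanSpace ℝ (Fin n)))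
    (hK : ∀ r : ℝ, 0 < r → ∀ x, supportFn K (r • x) = r * supportFn K x) :
    (∫ x, supportFn K x ∂(stdGaussian (EuclideanSpace ℝ (Fin n)))) * gaussMoment (1 / 2) (n - 1) =
      meanWidth K * gaussMoment (1 / 2) n := by
  have : NeZero n := ⟨hn⟩
  -- The constant function 1 yields the total mass of the sphere, which removes the normalising
  -- constants from `h2`.
  have h1 := integral_homogeneous_stdGaussian hn 0 (f := fun _ => 1) (by simp)
  have h2 := integral_homogeneous_stdGaussian hn 1 (f := supportFn K) (by simpa using hK)
  rw [Nat.sub_add_cancel (Nat.one_le_iff_ne_zero.2 hn)] at h2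
  simp only [integral_const, probReal_univ, smul_eq_mul, mul_one, add_zero] at h1
  rw [h2, meanWidth, sphereProb, integral_smul_measure, ENNReal.toReal_inv, smul_eq_mul]
  have h3 : (volume : Measure (EuclideanSpace ℝ (Fin n))).toSphere.real Set.univ ≠ 0 := by
    intro h
    rw [h] at h1
    simp at h1
  rw [← measureReal_def]
  generalize ((2 * Real.pi) ^ (n / 2 : ℝ))⁻¹ = c at *
  field_simp
  linear_combination (-(∫ u, supportFn K (u : EuclideanSpace ℝ (Fin n))
          ∂(volume : Measure (EuclideanSpace ℝ (Fin n))).toSphere) *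
          gaussMoment (1 / 2) n) * h1

theorem supportFn_convexHull_range {n : ℕ} {ι : Type*} [Finite ι] [Nonempty ι]
    (p : ι → EuclideanSpace ℝ (Fin n)) (u : EuclideanSpace ℝ (Fin n)) :
    supportFn (convexHull ℝ (Set.range p)) u = ⨆ i, inner ℝ (p i) u := by
  have hconv : ConvexOn ℝ Set.univ (fun y : EuclideanSpace ℝ (Fin n) => inner ℝ u y) :=
    (innerSL ℝ u).toLinearMap.convexOn convex_univ
  have hb : BddAbove (Set.range fun i => inner ℝ (p i) u) := Set.finite_range _ |>.bddAbove
  refine IsLUB.csSup_eq ⟨?_, fun b hbd => ciSup_le fun i => ?_⟩ ?_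
  · rintro _ ⟨y, hy, rfl⟩
    -- A convex function on a convex hull is dominated by its value at some generating point.
    obtain ⟨_, ⟨i, rfl⟩, hi⟩ := hconv.exists_ge_of_mem_convexHull (Set.subset_univ _) hy
    refine hi.trans ?_
    rw [real_inner_comm]
    exact le_ciSup hb i
  · rw [real_inner_comm]
    exact hbd ⟨p i, subset_convexHull ℝ _ ⟨i, rfl⟩, rfl⟩
  · exact ((Set.range_nonempty p).convexHull).image _

/-! ### Gaussian maxima depend only on distances. -/

section

variable {E F ι : Type*} [NormedAddCommGroup E] [InnerProductSpace ℝ E]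
  [NormedAddCommGroup F] [InnerProductSpace ℝ F]

/-- The linear map `x ↦ (⟪a i, x⟫)ᵢ` given by a finite family of vectors. -/
noncomputable def innerFamily (a : ι → E) : E →L[ℝ] EuclideanSpace ℝ ι :=
  (EuclideanSpace.equiv ι ℝ).symm.toContinuousLinearMap ∘L
    ContinuousLinearMap.pi fun i => innerSL ℝ (a i)

theorem innerFamily_apply (a : ι → E) (x : E) (i : ι) : innerFamily a x i = inner ℝ (a i) x := rfl

variable [Fintype ι] [FiniteDimensional ℝ E] [MeasurableSpace E] [BorelSpace E]
  [FiniteDimensional ℝ F] [MeasurableSpace F] [BorelSpace F]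

theorem charFun_map_innerFamily (a : ι → E) (t : EuclideanSpace ℝ ι) :
    charFun ((stdGaussian E).map (innerFamily a)) t =
      Complex.exp (-((∑ i, ∑ j, t i * t j * inner ℝ (a i) (a j) : ℝ) : ℂ) / 2) := by
  have h : ∀ x : E, inner ℝ (innerFamily a x) t = inner ℝ x (∑ i, t i • a i) := by
    intro x
    rw [inner_sum, PiLp.inner_apply]
    refine Finset.sum_congr rfl fun i _ => ?_
    rw [innerFamily_apply, inner_smul_right, real_inner_comm x]
    simp
  have h2 : ‖∑ i, t i • a i‖ ^ 2 = ∑ i, ∑ j, t i * t j * inner ℝ (a i) (a j) := by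
    rw [← real_inner_self_eq_norm_sq, sum_inner]
    refine Finset.sum_congr rfl fun i _ => ?_
    rw [inner_sum]
    refine Finset.sum_congr rfl fun j _ => ?_
    rw [inner_smul_left, inner_smul_right]
    simp [mul_assoc]
  rw [charFun_apply, integral_map (by fun_prop) (by fun_prop)]
  simp_rw [h]
  rw [← charFun_apply, charFun_stdGaussian, ← h2]
  norm_cast

/-- A centred Gaussian law is determined by its covariance, here the Gram matrix. -/
theorem map_innerFamily_congr {a : ι → E} {b : ι → F}
    (h : ∀ i j, inner ℝ (a i) (a j) = inner ℝ (b i) (b j)) :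
    (stdGaussian E).map (innerFamily a) = (stdGaussian F).map (innerFamily b) := by
  have := Measure.isProbabilityMeasure_map (μ := stdGaussian E)
    (innerFamily a).continuous.aemeasurable
  have := Measure.isProbabilityMeasure_map (μ := stdGaussian F)
    (innerFamily b).continuous.aemeasurable
  apply Measure.ext_of_charFun
  ext t
  simp_rw [charFun_map_innerFamily, h]

theorem measurable_iSup_coord : Measurable fun z : EuclideanSpace ℝ ι => ⨆ i, z i :=
  Measurable.iSup fun i => by fun_prop

variable [Nonempty ι]

theorem abs_iSup_le_sum_abs (z : ι → ℝ) : |⨆ i, z i| ≤ ∑ i, |z i| := by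
  obtain ⟨i, hi⟩ := exists_eq_ciSup_of_finite (f := z)
  rw [← hi]
  exact Finset.single_le_sum (f := fun i => |z i|) (fun i _ => abs_nonneg _) (Finset.mem_univ i)

theorem integrable_iSup_inner (a : ι → E) :
    Integrable (fun x => ⨆ i, inner ℝ (a i) x) (stdGaussian E) := by
  have h : Integrable (fun x : E => ∑ i, |inner ℝ (a i) x|) (stdGaussian E) :=
    integrable_finsetSum _ fun i _ =>
      ((innerSL ℝ (a i)).integrable_comp IsGaussian.integrable_id).abs
  refine h.mono' ?_ (.of_forall fun x => abs_iSup_le_sum_abs _)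
  exact (measurable_iSup_coord.comp (innerFamily a).continuous.measurable).aestronglyMeasurable

/-- The shift subtracts the linear functional `⟪c, x⟫` from the maximum, and that functional has
mean zero. -/
theorem integral_iSup_inner_sub (a : ι → E) (c : E) :
    ∫ x, ⨆ i, inner ℝ (a i - c) x ∂(stdGaussian E) = ∫ x, ⨆ i, inner ℝ (a i) x ∂(stdGaussian E) := by
  have h : ∀ x : E, ⨆ i, inner ℝ (a i - c) x = (⨆ i, inner ℝ (a i) x) - innerSL ℝ c x := by
    intro x
    simp_rw [inner_sub_left]
    exact (ciSup_sub (Set.finite_range _).bddAbove _).symm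
  simp_rw [h]
  rw [integral_sub (integrable_iSup_inner a)
    ((innerSL ℝ c).integrable_comp IsGaussian.integrable_fun_id), integral_strongDual_stdGaussian,
    sub_zero]

/-- The expected maximum of a Gaussian process `x ↦ ⟪a i, x⟫` depends only on the distances
between the vectors `a i`. -/
theorem integral_iSup_inner_congr {a : ι → E} {b : ι → F}
    (h : ∀ i j, dist (a i) (a j) = dist (b i) (b j)) :
    ∫ x, ⨆ i, inner ℝ (a i) x ∂(stdGaussian E) = ∫ y, ⨆ i, inner ℝ (b i) y ∂(stdGaussian F) := by
  obtain ⟨k⟩ := ‹Nonempty ι›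
  have hE : ∀ i j, inner ℝ (a i - a k) (a j - a k) =
      (dist (a i) (a k) ^ 2 + dist (a j) (a k) ^ 2 - dist (a i) (a j) ^ 2) / 2 := by
    intro i j
    rw [real_inner_eq_norm_mul_self_add_norm_mul_self_sub_norm_sub_mul_self_div_two,
      sub_sub_sub_cancel_right]
    simp only [dist_eq_norm]
    ring
  have hF : ∀ i j, inner ℝ (b i - b k) (b j - b k) =
      (dist (b i) (b k) ^ 2 + dist (b j) (b k) ^ 2 - dist (b i) (b j) ^ 2) / 2 := by
    intro i j
    rw [real_inner_eq_norm_mul_self_add_norm_mul_self_sub_norm_sub_mul_self_div_two,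
      sub_sub_sub_cancel_right]
    simp only [dist_eq_norm]
    ring
  -- After moving one point to the origin, polarisation expresses the Gram matrix through distances
  -- alone.
  have hm := map_innerFamily_congr (a := fun i => a i - a k) (b := fun i => b i - b k)
    (fun i j => by rw [hE, hF, h, h, h])
  rw [← integral_iSup_inner_sub a (a k), ← integral_iSup_inner_sub b (b k)]
  have h1 := integral_map (μ := stdGaussian E) (φ := innerFamily fun i => a i - a k)
    (by fun_prop) (f := fun z => ⨆ i, z i) measurable_iSup_coord.aestronglyMeasurable
  have h2 := integral_map (μ := stdGaussian F) (φ := innerFamily fun i => b i - b k)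
    (by fun_prop) (f := fun z => ⨆ i, z i) measurable_iSup_coord.aestronglyMeasurable
  rw [hm, h2] at h1
  exact h1.symm

end

theorem integral_iSup_inner_of_dist_eq_one {E ι : Type*} [NormedAddCommGroup E]
    [InnerProductSpace ℝ E] [FiniteDimensional ℝ E] [MeasurableSpace E] [BorelSpace E]
    [Fintype ι] [Nonempty ι] {p : ι → E} (hp : ∀ i j, i ≠ j → dist (p i) (p j) = 1) :
    ∫ x, ⨆ i, inner ℝ (p i) x ∂(stdGaussian E) =
      (√2)⁻¹ * ∫ y : ι → ℝ, ⨆ i, y i ∂(Measure.pi fun _ => gaussianReal 0 1) := by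
  classical
  -- Standard basis vectors are at mutual distance `√2`, hence the scaling.
  rw [integral_iSup_inner_congr (F := EuclideanSpace ℝ ι)
    (b := fun i => (√2)⁻¹ • EuclideanSpace.single i (1 : ℝ)), ← map_pi_eq_stdGaussian,
    integral_map, ← integral_const_mul]
  · refine integral_congr_ae (.of_forall fun y => ?_)
    simp only [inner_smul_left, EuclideanSpace.inner_single_left]
    rw [Real.mul_iSup_of_nonneg (by positivity)]
    simp
  · fun_prop
  · exact (Measurable.iSup fun i => by fun_prop).aestronglyMeasurable
  · intro i j
    by_cases hij : i = j
    · simp [hij]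
    · rw [hp i j hij, dist_smul₀, EuclideanSpace.dist_eq, Finset.sum_eq_add i j hij]
      · have h' : j ≠ i := Ne.symm hij
        norm_num [Pi.single_apply, hij, h', Real.dist_eq]
        rw [abs_of_nonneg (by positivity), inv_mul_cancel₀ (by positivity)]
      · intro c _ hc
        simp [hc.1, hc.2]
      · simp
      · simp

/-! ### The centred normal distribution function. -/

/-- The odd part `t ↦ Φ(t) - 1/2` of the standard normal distribution function. -/
noncomputable def normalHalf (t : ℝ) : ℝ := ∫ x in (0 : ℝ)..t, gaussianPDFReal 0 1 x

theorem gaussianPDFReal_zero_one (x : ℝ) :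
    gaussianPDFReal 0 1 x = (√(2 * Real.pi))⁻¹ * Real.exp (-x ^ 2 / 2) := by
  simp [gaussianPDFReal]

theorem continuous_gaussianPDFReal_zero_one : Continuous (gaussianPDFReal 0 1) := by
  have : gaussianPDFReal 0 1 = fun x => (√(2 * Real.pi))⁻¹ * Real.exp (-x ^ 2 / 2) :=
    funext gaussianPDFReal_zero_one
  rw [this]
  fun_prop

theorem hasDerivAt_gaussianPDFReal_zero_one (x : ℝ) :
    HasDerivAt (gaussianPDFReal 0 1) (-x * gaussianPDFReal 0 1 x) x := by
  have : gaussianPDFReal 0 1 = fun x => (√(2 * Real.pi))⁻¹ * Real.exp (-x ^ 2 / 2) :=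
    funext gaussianPDFReal_zero_one
  rw [this]
  have h := ((((hasDerivAt_id x).pow 2).neg.div_const 2).exp).const_mul (√(2 * Real.pi))⁻¹
  convert! h using 1
  simp
  ring

theorem hasDerivAt_normalHalf (t : ℝ) : HasDerivAt normalHalf (gaussianPDFReal 0 1 t) t :=
  intervalIntegral.integral_hasDerivAt_right
    (continuous_gaussianPDFReal_zero_one.intervalIntegrable _ _)
    (continuous_gaussianPDFReal_zero_one.stronglyMeasurableAtFilter _ _)
    continuous_gaussianPDFReal_zero_one.continuousAt

theorem continuous_normalHalf : Continuous normalHalf :=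
  continuous_iff_continuousAt.2 fun t => (hasDerivAt_normalHalf t).continuousAt

theorem normalHalf_zero : normalHalf 0 = 0 := by simp [normalHalf]

theorem normalHalf_nonneg {t : ℝ} (ht : 0 ≤ t) : 0 ≤ normalHalf t :=
  intervalIntegral.integral_nonneg ht fun x _ => gaussianPDFReal_nonneg 0 1 x

theorem gaussianReal_real_Iio (t : ℝ) :
    (gaussianReal 0 1).real (Set.Iio t) = (gaussianReal 0 1).real (Set.Iic t) := by
  have := nullSingletonClass_gaussianReal (μ := 0) (v := 1) one_ne_zero
  exact measureReal_congr Iio_ae_eq_Iic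

theorem gaussianReal_real_Iio_neg (t : ℝ) :
    (gaussianReal 0 1).real (Set.Iio (-t)) = (gaussianReal 0 1).real (Set.Ioi t) := by
  have h := gaussianReal_map_neg (μ := 0) (v := 1)
  rw [neg_zero] at h
  conv_rhs => rw [← h]
  rw [map_measureReal_apply (by fun_prop) measurableSet_Ioi]
  congr 1
  ext x
  simp

theorem gaussianReal_real_Ioi (t : ℝ) :
    (gaussianReal 0 1).real (Set.Ioi t) = 1 - (gaussianReal 0 1).real (Set.Iic t) := by
  rw [← Set.compl_Iic, probReal_compl_eq_one_sub measurableSet_Iic]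

theorem gaussianReal_real_Iic (t : ℝ) :
    (gaussianReal 0 1).real (Set.Iic t) = 1 / 2 + normalHalf t := by
  have h0 : (gaussianReal 0 1).real (Set.Iic 0) = 1 / 2 := by
    have h1 := gaussianReal_real_Iio_neg 0
    rw [neg_zero, gaussianReal_real_Iio, gaussianReal_real_Ioi] at h1
    linarith
  have h : ∀ t, (gaussianReal 0 1).real (Set.Iic t) = ∫ x in Set.Iic t, gaussianPDFReal 0 1 x := by
    intro t
    rw [measureReal_def, gaussianReal_apply_eq_integral 0 one_ne_zero, ENNReal.toReal_ofReal]
    exact integral_nonneg fun x => gaussianPDFReal_nonneg 0 1 x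
  have h2 := intervalIntegral.integral_Iic_sub_Iic (μ := volume) (f := gaussianPDFReal 0 1)
    (a := 0) (b := t) (integrable_gaussianPDFReal 0 1).integrableOn
    (integrable_gaussianPDFReal 0 1).integrableOn
  rw [← h, ← h, h0] at h2
  rw [normalHalf]
  linarith

theorem normalHalf_le_half (t : ℝ) : normalHalf t ≤ 1 / 2 := by
  have h := gaussianReal_real_Iic t
  have h2 : (gaussianReal 0 1).real (Set.Iic t) ≤ 1 := measureReal_le_one
  linarith

/-- Chernoff's bound with the optimal exponent `t`. -/
theorem half_sub_normalHalf_le {t : ℝ} (ht : 0 ≤ t) :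
    1 / 2 - normalHalf t ≤ Real.exp (-(1 / 2) * t ^ 2) := by
  have h := measure_ge_le_exp_mul_mgf (μ := gaussianReal 0 1) (X := id) t ht
    (integrable_exp_mul_gaussianReal t)
  rw [mgf_gaussianReal (X := id) (μ := 0) (v := 1) Measure.map_id, ← Real.exp_add] at h
  have h1 : (gaussianReal 0 1).real (Set.Ioi t) ≤ (gaussianReal 0 1).real {x | t ≤ id x} :=
    measureReal_mono fun x (hx : t < x) => hx.le
  rw [gaussianReal_real_Ioi, gaussianReal_real_Iic] at h1
  have h2 : -t * t + (0 * t + ((1 : NNReal) : ℝ) * t ^ 2 / 2) = -(1 / 2) * t ^ 2 := by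
    push_cast; ring
  rw [h2] at h
  linarith

/-! ### The expected maximum of independent normals. -/

section

variable {ι : Type*} [Fintype ι]

theorem integrable_iSup_pi_gaussianReal [Nonempty ι] :
    Integrable (fun y : ι → ℝ => ⨆ i, y i) (Measure.pi fun _ => gaussianReal 0 1) := by
  have h : Integrable (fun y : ι → ℝ => ∑ i, |y i|) (Measure.pi fun _ => gaussianReal 0 1) :=
    integrable_finsetSum _ fun i _ => (integrable_eval IsGaussian.integrable_id).abs
  exact h.mono' (Measurable.iSup fun i => by fun_prop).aestronglyMeasurable
    (.of_forall fun x => abs_iSup_le_sum_abs _)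

theorem pi_gaussianReal_real_pi (s : Set ℝ) :
    (Measure.pi fun _ : ι => gaussianReal 0 1).real (Set.univ.pi fun _ => s) =
      (gaussianReal 0 1).real s ^ Fintype.card ι := by
  simp [measureReal_def, Measure.pi_pi]

theorem one_sub_pow_le_mul {u : ℝ} (h1 : u ≤ 1) (N : ℕ) :
    1 - (1 - u) ^ N ≤ N * u := by
  have := one_add_mul_le_pow (a := -u) (by linarith) N
  rw [← sub_eq_add_neg] at this
  linarith

theorem integrableOn_one_sub_normal_pow (N : ℕ) :
    IntegrableOn (fun t => 1 - (1 / 2 + normalHalf t) ^ N) (Set.Ioi 0) := by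
  have h := (integrableOn_pow_mul_exp_neg_mul_sq (a := 1 / 2) (by norm_num) 0).const_mul N
  refine h.mono' ?_ ?_
  · have := continuous_normalHalf
    exact (by fun_prop : Continuous fun t => 1 - (1 / 2 + normalHalf t) ^ N).aestronglyMeasurable
  · filter_upwards [ae_restrict_mem measurableSet_Ioi] with t ht
    have ht' : (0 : ℝ) ≤ t := le_of_lt ht
    have h1 := half_sub_normalHalf_le ht'
    have h2 := normalHalf_le_half t
    have h3 := normalHalf_nonneg ht'
    have h4 := one_sub_pow_le_mul (u := 1 / 2 - normalHalf t) (by linarith) N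
    rw [show 1 - (1 / 2 - normalHalf t) = 1 / 2 + normalHalf t by ring] at h4
    have h5 : (1 / 2 + normalHalf t) ^ N ≤ 1 := pow_le_one₀ (by linarith) (by linarith)
    rw [Real.norm_of_nonneg (by linarith), pow_zero, one_mul]
    exact h4.trans (by gcongr)

theorem integrableOn_normal_tail_pow {N : ℕ} (hN : N ≠ 0) :
    IntegrableOn (fun t => (1 / 2 - normalHalf t) ^ N) (Set.Ioi 0) := by
  have h := (integrableOn_pow_mul_exp_neg_mul_sq (a := 1 / 2) (by norm_num) 0)
  refine h.mono' ?_ ?_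
  · have := continuous_normalHalf
    exact (by fun_prop : Continuous fun t => (1 / 2 - normalHalf t) ^ N).aestronglyMeasurable
  · filter_upwards [ae_restrict_mem measurableSet_Ioi] with t ht
    have ht' : (0 : ℝ) ≤ t := le_of_lt ht
    have h1 := half_sub_normalHalf_le ht'
    have h2 := normalHalf_le_half t
    have h3 := normalHalf_nonneg ht'
    rw [Real.norm_of_nonneg (pow_nonneg (by linarith) _), pow_zero, one_mul]
    exact (pow_le_of_le_one (by linarith) (by linarith) hN).trans h1

theorem integral_iSup_pi_gaussianReal [Nonempty ι] :
    ∫ y : ι → ℝ, ⨆ i, y i ∂(Measure.pi fun _ => gaussianReal 0 1) =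
      ∫ t in Set.Ioi (0 : ℝ), (1 - (1 / 2 + normalHalf t) ^ Fintype.card ι -
        (1 / 2 - normalHalf t) ^ Fintype.card ι) := by
  set μ : Measure (ι → ℝ) := Measure.pi fun _ => gaussianReal 0 1 with hμ
  have hi := integrable_iSup_pi_gaussianReal (ι := ι)
  -- Layer-cake is applied to the positive and negative parts: the maximum exceeds `t` unless all
  -- coordinates are at most `t`, and is below `-t` when all coordinates are.
  have e : ∀ y : ι → ℝ, ⨆ i, y i = max (⨆ i, y i) 0 - max (-⨆ i, y i) 0 := fun y => by
    rcases le_total 0 (⨆ i, y i) with h | h <;> simp [h]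
  rw [integral_congr_ae (.of_forall e), integral_sub hi.pos_part hi.neg_part,
    Integrable.integral_eq_integral_meas_lt hi.pos_part (.of_forall fun y => le_max_right _ _),
    Integrable.integral_eq_integral_meas_lt hi.neg_part (.of_forall fun y => le_max_right _ _),
    integral_sub (integrableOn_one_sub_normal_pow _)
      (integrableOn_normal_tail_pow Fintype.card_ne_zero)]
  congr 1
  · refine setIntegral_congr_fun measurableSet_Ioi fun t (ht : 0 < t) => ?_
    have hs : {y : ι → ℝ | t < max (⨆ i, y i) 0} = (Set.univ.pi fun _ => Set.Iic t)ᶜ := by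
      ext y
      simp only [Set.mem_ofPred_eq, lt_max_iff, ht.not_gt, or_false, Set.mem_compl_iff,
        Set.mem_univ_pi, Set.mem_Iic]
      rw [← not_le, ciSup_le_iff (Set.finite_range _).bddAbove]
    rw [hs, probReal_compl_eq_one_sub (MeasurableSet.univ_pi fun _ => measurableSet_Iic),
      pi_gaussianReal_real_pi, gaussianReal_real_Iic]
  · refine setIntegral_congr_fun measurableSet_Ioi fun t (ht : 0 < t) => ?_
    have hs : {y : ι → ℝ | t < max (-⨆ i, y i) 0} = Set.univ.pi fun _ => Set.Iio (-t) := by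
      ext y
      simp only [Set.mem_ofPred_eq, lt_max_iff, ht.not_gt, or_false,
        Set.mem_univ_pi, Set.mem_Iio, lt_neg]
      obtain ⟨i, hi⟩ := exists_eq_ciSup_of_finite (f := y)
      exact ⟨fun h j => by
        have := le_ciSup (Set.finite_range y).bddAbove j
        linarith, fun h => hi ▸ h i⟩
    rw [hs, pi_gaussianReal_real_pi, gaussianReal_real_Iio_neg, gaussianReal_real_Ioi,
      gaussianReal_real_Iic]
    congr 1
    ring

end

/-! ### Integration by parts. -/

theorem tendsto_exp_neg_half_sq : Tendsto (fun t : ℝ => t * Real.exp (-(1 / 2) * t ^ 2))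
    atTop (𝓝 0) := by
  have h := tendsto_rpow_abs_mul_exp_neg_mul_sq_cocompact (a := 1 / 2) (by norm_num) 1
  refine (h.mono_left atTop_le_cocompact).congr' ?_
  filter_upwards [eventually_ge_atTop 0] with t ht
  rw [abs_of_nonneg ht, Real.rpow_one]

theorem tendsto_normalHalf : Tendsto normalHalf atTop (𝓝 (1 / 2)) := by
  have h0 : Tendsto (fun t : ℝ => 1 / 2 - Real.exp (-(1 / 2) * t ^ 2)) atTop (𝓝 (1 / 2)) := by
    have : Tendsto (fun t : ℝ => Real.exp (-(1 / 2) * t ^ 2)) atTop (𝓝 0) := by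
      refine Real.tendsto_exp_atBot.comp ?_
      exact (tendsto_pow_atTop two_ne_zero).const_mul_atTop_of_neg (by norm_num)
    simpa only [sub_zero] using this.const_sub (1 / 2)
  refine tendsto_of_tendsto_of_tendsto_of_le_of_le' h0 tendsto_const_nhds ?_
    (.of_forall normalHalf_le_half)
  filter_upwards [eventually_ge_atTop 0] with t ht
  have := half_sub_normalHalf_le ht
  linarith

theorem gaussianPDFReal_zero_one_sq (x : ℝ) :
    gaussianPDFReal 0 1 x ^ 2 = (2 * Real.pi)⁻¹ * Real.exp (-1 * x ^ 2) := by
  rw [gaussianPDFReal_zero_one, mul_pow, inv_pow, Real.sq_sqrt (by positivity), ← Real.exp_nat_mul]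
  congr 2
  push_cast
  ring

theorem tendsto_gaussianPDFReal_zero_one : Tendsto (gaussianPDFReal 0 1) atTop (𝓝 0) := by
  have h : Tendsto (fun t : ℝ => (√(2 * Real.pi))⁻¹ * Real.exp (-t ^ 2 / 2)) atTop
      (𝓝 ((√(2 * Real.pi))⁻¹ * 0)) := by
    refine Tendsto.const_mul _ (Real.tendsto_exp_atBot.comp ?_)
    have := (tendsto_pow_atTop (α := ℝ) two_ne_zero).const_mul_atTop_of_neg
      (show (-(1 / 2) : ℝ) < 0 by norm_num)
    exact this.congr fun x => by ring
  rw [mul_zero] at h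
  exact h.congr fun x => (gaussianPDFReal_zero_one x).symm

theorem integrableOn_exp_mul_of_abs_le {f : ℝ → ℝ} (hf : Continuous f) {C : ℝ}
    (hC : ∀ t, 0 ≤ t → |f t| ≤ C) :
    IntegrableOn (fun t => Real.exp (-1 * t ^ 2) * f t) (Set.Ioi 0) := by
  have h := (integrableOn_pow_mul_exp_neg_mul_sq (a := 1) (by norm_num) 0).mul_const C
  refine h.mono' (by fun_prop) ?_
  filter_upwards [ae_restrict_mem measurableSet_Ioi] with t ht
  rw [norm_mul, Real.norm_of_nonneg (Real.exp_pos _).le, pow_zero, one_mul]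
  gcongr
  exact hC t (le_of_lt ht)

theorem abs_normalHalf_le {t : ℝ} (ht : 0 ≤ t) : |normalHalf t| ≤ 1 / 2 := by
  rw [abs_of_nonneg (normalHalf_nonneg ht)]
  exact normalHalf_le_half t

theorem integral_one_sub_normal_pow (m : ℕ) :
    ∫ t in Set.Ioi (0 : ℝ), (1 - (1 / 2 + normalHalf t) ^ (m + 2) -
        (1 / 2 - normalHalf t) ^ (m + 2)) =
      (m + 2) * (m + 1) * (2 * Real.pi)⁻¹ * ∫ t in Set.Ioi (0 : ℝ), Real.exp (-1 * t ^ 2) *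
        ((1 / 2 + normalHalf t) ^ m + (1 / 2 - normalHalf t) ^ m) := by
  set φ := gaussianPDFReal 0 1 with hφ
  set A : ℝ → ℝ := fun t => 1 - (1 / 2 + normalHalf t) ^ (m + 2) -
        (1 / 2 - normalHalf t) ^ (m + 2) with hA
  set D : ℝ → ℝ := fun t => (1 / 2 + normalHalf t) ^ (m + 1) - (1 / 2 - normalHalf t) ^ (m + 1)
    with hD
  set B : ℝ → ℝ := fun t => Real.exp (-1 * t ^ 2) *
        ((1 / 2 + normalHalf t) ^ m + (1 / 2 - normalHalf t) ^ m) with hB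
  set c : ℝ := (m + 2) * (m + 1) * (2 * Real.pi)⁻¹ with hc
  have hcont := continuous_normalHalf
  have hAi : IntegrableOn A (Set.Ioi 0) :=
    (integrableOn_one_sub_normal_pow _).sub (integrableOn_normal_tail_pow (by omega))
  have hBi : IntegrableOn B (Set.Ioi 0) := by
    refine integrableOn_exp_mul_of_abs_le (by fun_prop) (C := 2) fun t ht => ?_
    have h2 := normalHalf_le_half t
    have h3 := normalHalf_nonneg ht
    have h4 : (1 / 2 + normalHalf t) ^ m ≤ 1 := pow_le_one₀ (by linarith) (by linarith)
    have h5 : (1 / 2 - normalHalf t) ^ m ≤ 1 := pow_le_one₀ (by linarith) (by linarith)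
    have h6 : 0 ≤ (1 / 2 + normalHalf t) ^ m := pow_nonneg (by linarith) _
    have h7 : 0 ≤ (1 / 2 - normalHalf t) ^ m := pow_nonneg (by linarith) _
    rw [abs_of_nonneg (by linarith)]
    linarith
  -- Since `A' = -(m+2) φ D` and `φ' = -t φ`, the two terms in `t φ D` cancel. What remains beside
  -- `A` is `-(m+2) φ D'`, which contains `φ² = exp (-t²) / (2π)`.
  have hder : ∀ t, HasDerivAt (fun t => t * A t - (m + 2) * (φ t * D t)) (A t - c * B t) t := by
    intro t
    have hψ := hasDerivAt_normalHalf t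
    have hp := hψ.const_add (1 / 2)
    have hm := hψ.const_sub (1 / 2)
    have hA' := ((hp.fun_pow (m + 2)).const_sub 1).sub (hm.fun_pow (m + 2))
    have hD' := (hp.fun_pow (m + 1)).sub (hm.fun_pow (m + 1))
    have h := ((hasDerivAt_id t).mul hA').sub
      (((hasDerivAt_gaussianPDFReal_zero_one t).mul hD').const_mul ((m : ℝ) + 2))
    refine h.congr_deriv ?_
    have hsq := gaussianPDFReal_zero_one_sq t
    simp only [hA, hB, hc, Pi.sub_apply, id, ← hφ] at hsq ⊢
    push_cast
    linear_combination (-((m : ℝ) + 2) * (m + 1) *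
      ((1 / 2 + normalHalf t) ^ m + (1 / 2 - normalHalf t) ^ m)) * hsq
  have hlim : Tendsto (fun t => t * A t - (m + 2) * (φ t * D t)) atTop (𝓝 0) := by
    have h1 : Tendsto (fun t => t * A t) atTop (𝓝 0) := by
      have hb := tendsto_exp_neg_half_sq.const_mul ((m : ℝ) + 2 + 1)
      rw [mul_zero] at hb
      refine squeeze_zero_norm' ?_ hb
      filter_upwards [eventually_ge_atTop 0] with t ht
      have h1 := half_sub_normalHalf_le ht
      have h2 := normalHalf_le_half t
      have h3 := normalHalf_nonneg ht
      have h4 := one_sub_pow_le_mul (u := 1 / 2 - normalHalf t) (by linarith) (m + 2)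
      rw [show 1 - (1 / 2 - normalHalf t) = 1 / 2 + normalHalf t by ring] at h4
      push_cast at h4
      have h5 : (1 / 2 + normalHalf t) ^ (m + 2) ≤ 1 := pow_le_one₀ (by linarith) (by linarith)
      have h6 : 0 ≤ (1 / 2 - normalHalf t) ^ (m + 2) := pow_nonneg (by linarith) _
      have h7 : (1 / 2 - normalHalf t) ^ (m + 2) ≤ 1 / 2 - normalHalf t :=
        pow_le_of_le_one (by linarith) (by linarith) (by omega)
      have h8 : |A t| ≤ ((m : ℝ) + 2 + 1) * Real.exp (-(1 / 2) * t ^ 2) := by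
        have h9 : ((m : ℝ) + 2) * (1 / 2 - normalHalf t) ≤
          ((m : ℝ) + 2) * Real.exp (-(1 / 2) * t ^ 2) := by gcongr
        have h10 : 0 ≤ ((m : ℝ) + 2) * Real.exp (-(1 / 2) * t ^ 2) := by positivity
        rw [abs_le]
        constructor <;> simp only [hA] <;> linarith
      rw [norm_mul, Real.norm_of_nonneg ht]
      calc t * |A t| ≤ t * (((m : ℝ) + 2 + 1) * Real.exp (-(1 / 2) * t ^ 2)) := by gcongr
        _ = _ := by ring
    have h2 : Tendsto D atTop (𝓝 ((1 / 2 + 1 / 2) ^ (m + 1) - (1 / 2 - 1 / 2) ^ (m + 1))) :=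
      ((tendsto_normalHalf.const_add _).pow _).sub ((tendsto_normalHalf.const_sub _).pow _)
    have h3 := h1.sub ((tendsto_gaussianPDFReal_zero_one.mul h2).const_mul ((m : ℝ) + 2))
    simpa using h3
  have key := integral_Ioi_of_hasDerivAt_of_tendsto' (a := 0) (fun t _ => hder t)
    (hAi.sub (hBi.const_mul c)) hlim
  rw [integral_sub hAi (hBi.const_mul c), integral_const_mul] at key
  have hD0 : D 0 = 0 := by simp [hD, normalHalf_zero]
  rw [hD0] at key
  linarith

/-! ### Even moments of the centred distribution function. -/

/-- The even moments `∫₀^∞ exp (-t²) (Φ(t) - 1/2) ^ (2k) dt`. -/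
noncomputable def normalHalfMoment (k : ℕ) : ℝ :=
  ∫ t in Set.Ioi (0 : ℝ), Real.exp (-1 * t ^ 2) * normalHalf t ^ (2 * k)

theorem integrableOn_exp_mul_normalHalf_pow (k : ℕ) :
    IntegrableOn (fun t => Real.exp (-1 * t ^ 2) * normalHalf t ^ k) (Set.Ioi 0) := by
  have hcont := continuous_normalHalf
  refine integrableOn_exp_mul_of_abs_le (by fun_prop) (C := (1 / 2) ^ k) fun t ht => ?_
  rw [abs_pow]
  exact pow_le_pow_left₀ (abs_nonneg _) (abs_normalHalf_le ht) k

theorem normalHalfMoment_zero : normalHalfMoment 0 = √Real.pi / 2 := by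
  have h := gaussMoment_zero (a := 1) one_pos
  simpa [gaussMoment, normalHalfMoment] using h

theorem integral_exp_mul_even_poly (c₀ c₁ c₂ c₃ : ℝ) :
    ∫ t in Set.Ioi (0 : ℝ), Real.exp (-1 * t ^ 2) * (c₀ + c₁ * normalHalf t ^ 2 +
      c₂ * normalHalf t ^ 4 + c₃ * normalHalf t ^ 6) =
    c₀ * (√Real.pi / 2) + c₁ * normalHalfMoment 1 + c₂ * normalHalfMoment 2 +
      c₃ * normalHalfMoment 3 := by
  have h := integrableOn_exp_mul_normalHalf_pow
  rw [← normalHalfMoment_zero]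
  simp only [normalHalfMoment, ← integral_const_mul]
  rw [← integral_add ((h _).const_mul _) ((h _).const_mul _), ← integral_add _ ((h _).const_mul _),
    ← integral_add _ ((h _).const_mul _)]
  · congr 1
    ext t
    ring
  · exact (((h _).const_mul _).add ((h _).const_mul _)).add ((h _).const_mul _)
  · exact ((h _).const_mul _).add ((h _).const_mul _)

/-! ### Series bounds for the distribution function and its moments. -/

open scoped Nat

/-- The partial sum `∑ j ≤ N, x ^ (2j+1) / (2j+1)‼` of the Taylor series of `(Φ - 1/2) / φ`. -/
noncomputable def oddSeries (N : ℕ) (x : ℝ) : ℝ :=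
  ∑ j ∈ Finset.range (N + 1), x ^ (2 * j + 1) / ((2 * j + 1)‼ : ℝ)

theorem oddSeries_succ (N : ℕ) (x : ℝ) :
    oddSeries (N + 1) x = oddSeries N x + x ^ (2 * N + 3) / ((2 * N + 3)‼ : ℝ) := by
  rw [oddSeries, Finset.sum_range_succ, ← oddSeries]
  rfl

theorem doubleFactorial_two_mul_add_three (N : ℕ) :
    ((2 * N + 3)‼ : ℝ) = (2 * N + 3) * ((2 * N + 1)‼ : ℝ) := by
  rw [show 2 * N + 3 = 2 * N + 1 + 2 by ring, Nat.doubleFactorial_add_two]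
  push_cast
  ring

theorem doubleFactorial_cast_pos (n : ℕ) : (0 : ℝ) < (n‼ : ℝ) := by
  exact_mod_cast Nat.doubleFactorial_pos n

/-- The derivative telescopes, because `φ' = -x φ` makes each term cancel against the derivative of
the next. -/
theorem hasDerivAt_gaussianPDFReal_mul_oddSeries (N : ℕ) (x : ℝ) :
    HasDerivAt (fun x => gaussianPDFReal 0 1 x * oddSeries N x)
      (gaussianPDFReal 0 1 x * (1 - x ^ (2 * N + 2) / ((2 * N + 1)‼ : ℝ))) x := by
  have hφ := hasDerivAt_gaussianPDFReal_zero_one x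
  induction N with
  | zero =>
    have h := hφ.mul (hasDerivAt_id x)
    refine (h.congr_deriv ?_).congr_of_eventuallyEq (.of_forall fun y => ?_)
    · simp
      ring
    · simp [oddSeries]
  | succ N ih =>
    have h := ih.add (hφ.mul ((hasDerivAt_pow (2 * N + 3) x).div_const ((2 * N + 3)‼ : ℝ)))
    refine (h.congr_deriv ?_).congr_of_eventuallyEq (.of_forall fun y => ?_)
    · rw [show 2 * (N + 1) + 1 = 2 * N + 3 by ring, doubleFactorial_two_mul_add_three]
      have := doubleFactorial_cast_pos (2 * N + 1)
      simp only [show 2 * N + 3 - 1 = 2 * N + 2 by omega]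
      push_cast
      field_simp
      ring
    · simp only [oddSeries_succ, Pi.add_apply, Pi.mul_apply]
      ring

theorem oddSeries_nonneg (N : ℕ) {x : ℝ} (hx : 0 ≤ x) : 0 ≤ oddSeries N x :=
  Finset.sum_nonneg fun _ _ => by positivity

theorem oddSeries_zero_right (N : ℕ) : oddSeries N 0 = 0 := by
  simp [oddSeries]

theorem gaussianPDFReal_mul_oddSeries_le (N : ℕ) {x : ℝ} (hx : 0 ≤ x) :
    gaussianPDFReal 0 1 x * oddSeries N x ≤ normalHalf x := by
  have hd : ∀ y, HasDerivAt (fun y => normalHalf y - gaussianPDFReal 0 1 y * oddSeries N y)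
      (gaussianPDFReal 0 1 y * (y ^ (2 * N + 2) / ((2 * N + 1)‼ : ℝ))) y := fun y =>
    ((hasDerivAt_normalHalf y).sub (hasDerivAt_gaussianPDFReal_mul_oddSeries N y)).congr_deriv
      (by ring)
  have hm : Monotone (fun y => normalHalf y - gaussianPDFReal 0 1 y * oddSeries N y) :=
    monotone_of_hasDerivAt_nonneg hd fun y => by
      have h1 := gaussianPDFReal_nonneg 0 1 y
      have h2 : 0 ≤ y ^ (2 * N + 2) := Even.pow_nonneg ⟨N + 1, by ring⟩ y
      have := doubleFactorial_cast_pos (2 * N + 1)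
      simp only [Pi.zero_apply]
      positivity
  have h := hm hx
  simp only [normalHalf_zero, oddSeries_zero_right, mul_zero, sub_zero] at h
  linarith

/-- The defect of the truncation has derivative `φ y^(2N+2) / (2N+1)‼`. Bounding `φ` by its maximum
`1/√(2π)` and integrating gives the remainder. -/
theorem normalHalf_le_add (N : ℕ) {x : ℝ} (hx : 0 ≤ x) :
    normalHalf x ≤ gaussianPDFReal 0 1 x * oddSeries N x +
      (√(2 * Real.pi))⁻¹ * (x ^ (2 * N + 3) / ((2 * N + 3)‼ : ℝ)) := by
  have hd : ∀ y, HasDerivAt (fun y => gaussianPDFReal 0 1 y * oddSeries N y +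
      (√(2 * Real.pi))⁻¹ * (y ^ (2 * N + 3) / ((2 * N + 3)‼ : ℝ)) - normalHalf y)
      (((√(2 * Real.pi))⁻¹ - gaussianPDFReal 0 1 y) *
        (y ^ (2 * N + 2) / ((2 * N + 1)‼ : ℝ))) y := fun y => by
    have h := ((hasDerivAt_gaussianPDFReal_mul_oddSeries N y).add
      (((hasDerivAt_pow (2 * N + 3) y).div_const ((2 * N + 3)‼ : ℝ)).const_mul
        (√(2 * Real.pi))⁻¹)).sub (hasDerivAt_normalHalf y)
    refine h.congr_deriv ?_
    rw [doubleFactorial_two_mul_add_three]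
    have := doubleFactorial_cast_pos (2 * N + 1)
    simp only [show 2 * N + 3 - 1 = 2 * N + 2 by omega]
    push_cast
    field_simp
    ring
  have hm := monotone_of_hasDerivAt_nonneg hd fun y => by
      have h1 : gaussianPDFReal 0 1 y ≤ (√(2 * Real.pi))⁻¹ := by
        rw [gaussianPDFReal_zero_one]
        refine mul_le_of_le_one_right (by positivity) (Real.exp_le_one_iff.2 ?_)
        nlinarith [sq_nonneg y]
      have h2 : 0 ≤ y ^ (2 * N + 2) := Even.pow_nonneg ⟨N + 1, by ring⟩ y
      have := doubleFactorial_cast_pos (2 * N + 1)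
      have h3 := sub_nonneg.2 h1
      simp only [Pi.zero_apply]
      positivity
  have h := hm hx
  simp only [normalHalf_zero, oddSeries_zero_right, mul_zero, sub_zero] at h
  rw [zero_pow (by omega)] at h
  simp only [zero_div, mul_zero, add_zero] at h
  linarith

theorem continuous_oddSeries (N : ℕ) : Continuous (oddSeries N) := by
  unfold oddSeries
  fun_prop

theorem exp_mul_gaussianPDFReal_mul_oddSeries_pow (N k : ℕ) (t : ℝ) :
    Real.exp (-1 * t ^ 2) * (gaussianPDFReal 0 1 t * oddSeries N t) ^ (2 * k) =
      ((2 * Real.pi) ^ k)⁻¹ * (Real.exp (-(k + 1) * t ^ 2) * oddSeries N t ^ (2 * k)) := by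
  rw [mul_pow, pow_mul (gaussianPDFReal 0 1 t), gaussianPDFReal_zero_one_sq, mul_pow,
    ← Real.exp_nat_mul, inv_pow]
  have : Real.exp (-(k + 1) * t ^ 2) =
      Real.exp (-1 * t ^ 2) * Real.exp (k * (-1 * t ^ 2)) := by
    rw [← Real.exp_add]
    congr 1
    ring
  rw [this]
  ring

theorem integrableOn_exp_mul_gaussianPDFReal_mul_oddSeries (N k : ℕ) :
    IntegrableOn (fun t => Real.exp (-1 * t ^ 2) *
      (gaussianPDFReal 0 1 t * oddSeries N t) ^ (2 * k)) (Set.Ioi 0) := by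
  refine (integrableOn_exp_mul_normalHalf_pow (2 * k)).mono' ?_ ?_
  · have h1 := continuous_gaussianPDFReal_zero_one
    have h2 := continuous_oddSeries N
    fun_prop
  · filter_upwards [ae_restrict_mem measurableSet_Ioi] with t ht
    have ht' : (0 : ℝ) ≤ t := le_of_lt ht
    have h1 := mul_nonneg (gaussianPDFReal_nonneg 0 1 t) (oddSeries_nonneg N ht')
    have h2 := gaussianPDFReal_mul_oddSeries_le N ht'
    rw [Real.norm_of_nonneg (by positivity)]
    gcongr

theorem le_normalHalfMoment (N k : ℕ) :
    ((2 * Real.pi) ^ k)⁻¹ * (∫ t in Set.Ioi (0 : ℝ),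
      Real.exp (-(k + 1) * t ^ 2) * oddSeries N t ^ (2 * k)) ≤ normalHalfMoment k := by
  rw [← integral_const_mul]
  simp_rw [← exp_mul_gaussianPDFReal_mul_oddSeries_pow]
  refine setIntegral_mono_on (integrableOn_exp_mul_gaussianPDFReal_mul_oddSeries N k)
    (integrableOn_exp_mul_normalHalf_pow (2 * k)) measurableSet_Ioi fun t ht => ?_
  have ht' : (0 : ℝ) ≤ t := le_of_lt ht
  have h1 := mul_nonneg (gaussianPDFReal_nonneg 0 1 t) (oddSeries_nonneg N ht')
  have h2 := gaussianPDFReal_mul_oddSeries_le N ht'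
  gcongr

theorem normalHalfMoment_le (N k : ℕ) :
    normalHalfMoment k ≤ ((2 * Real.pi) ^ k)⁻¹ * (∫ t in Set.Ioi (0 : ℝ),
      Real.exp (-(k + 1) * t ^ 2) * oddSeries N t ^ (2 * k)) +
      (2 * k) * (1 / 2) ^ (2 * k - 1) * ((√(2 * Real.pi))⁻¹ / ((2 * N + 3)‼ : ℝ)) *
        gaussMoment 1 (2 * N + 3) := by
  rw [← integral_const_mul, gaussMoment, ← integral_const_mul]
  simp_rw [← exp_mul_gaussianPDFReal_mul_oddSeries_pow]
  have hi := (integrableOn_pow_mul_exp_neg_mul_sq (a := 1) one_pos (2 * N + 3)).const_mul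
    ((2 * k) * (1 / 2) ^ (2 * k - 1) * ((√(2 * Real.pi))⁻¹ / ((2 * N + 3)‼ : ℝ)))
  rw [← integral_add (integrableOn_exp_mul_gaussianPDFReal_mul_oddSeries N k) hi]
  refine setIntegral_mono_on (integrableOn_exp_mul_normalHalf_pow (2 * k))
    ((integrableOn_exp_mul_gaussianPDFReal_mul_oddSeries N k).add hi) measurableSet_Ioi
    fun t ht => ?_
  have ht' : (0 : ℝ) ≤ t := le_of_lt ht
  have h1 := mul_nonneg (gaussianPDFReal_nonneg 0 1 t) (oddSeries_nonneg N ht')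
  have h2 := gaussianPDFReal_mul_oddSeries_le N ht'
  have h3 := normalHalf_le_add N ht'
  -- The error in the power is at most `2k` times the error in the base times `(1/2)^(2k-1)`, as
  -- both bases lie in `[0, 1/2]`.
  have h4 := abs_pow_sub_pow_le (normalHalf t) (gaussianPDFReal 0 1 t * oddSeries N t) (2 * k)
  rw [abs_of_nonneg (normalHalf_nonneg ht'), abs_of_nonneg h1, max_eq_left h2,
    abs_of_nonneg (sub_nonneg.2 h2)] at h4
  have h5 : normalHalf t ^ (2 * k - 1) ≤ (1 / 2) ^ (2 * k - 1) :=
    pow_le_pow_left₀ (normalHalf_nonneg ht') (normalHalf_le_half t) _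
  have h6 := (le_abs_self _).trans h4
  have h7 : (normalHalf t - gaussianPDFReal 0 1 t * oddSeries N t) * ((2 * k : ℕ) : ℝ) *
      normalHalf t ^ (2 * k - 1) ≤
      ((√(2 * Real.pi))⁻¹ * (t ^ (2 * N + 3) / ((2 * N + 3)‼ : ℝ))) * ((2 * k : ℕ) : ℝ) *
      (1 / 2) ^ (2 * k - 1) := by
    have := doubleFactorial_cast_pos (2 * N + 3)
    have h8 := pow_nonneg (normalHalf_nonneg ht') (2 * k - 1)
    gcongr
    linarith
  have h9 := mul_le_mul_of_nonneg_left (h6.trans h7) (Real.exp_pos (-1 * t ^ 2)).le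
  push_cast at h9
  rw [mul_sub] at h9
  refine (sub_le_iff_le_add'.1 h9).trans (le_of_eq ?_)
  ring

/-! ### Exact integration with natural-number coefficient lists. -/

namespace NatPoly

/-- Evaluation at a real number of the polynomial with a given list of coefficients. -/
def eval : List ℕ → ℝ → ℝ
  | [], _ => 0
  | c :: p, y => c + y * eval p y

/-- Sum of coefficient lists. -/
def add : List ℕ → List ℕ → List ℕ
  | [], q => q
  | p, [] => p
  | c :: p, d :: q => (c + d) :: add p q

/-- Scalar multiple of a coefficient list. -/
def smul (a : ℕ) : List ℕ → List ℕ
  | [] => []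
  | c :: p => (a * c) :: smul a p

/-- Product of coefficient lists. -/
def mul : List ℕ → List ℕ → List ℕ
  | [], _ => []
  | c :: p, q => add (smul c q) (0 :: mul p q)

theorem eval_add (p q : List ℕ) (y : ℝ) : eval (add p q) y = eval p y + eval q y := by
  induction p generalizing q with
  | nil => simp [add, eval]
  | cons c p ih =>
    cases q with
    | nil => simp [add, eval]
    | cons d q =>
      simp only [add, eval, ih]
      push_cast
      ring

theorem eval_smul (a : ℕ) (p : List ℕ) (y : ℝ) : eval (smul a p) y = a * eval p y := by
  induction p with
  | nil => simp [smul, eval]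
  | cons c p ih =>
    simp only [smul, eval, ih]
    push_cast
    ring

theorem eval_mul (p q : List ℕ) (y : ℝ) : eval (mul p q) y = eval p y * eval q y := by
  induction p with
  | nil => simp [mul, eval]
  | cons c p ih =>
    simp only [mul, eval, eval_add, eval_smul, ih]
    push_cast
    ring

theorem eval_append_singleton (p : List ℕ) (c : ℕ) (y : ℝ) :
    eval (p ++ [c]) y = eval p y + c * y ^ p.length := by
  induction p with
  | nil => simp [eval]
  | cons d p ih =>
    simp only [List.cons_append, eval, ih, List.length_cons]
    ring

theorem length_smul (a : ℕ) (p : List ℕ) : (smul a p).length = p.length := by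
  induction p with
  | nil => rfl
  | cons c p ih => simp [smul, ih]

/-- The coefficients `(2N+1)‼ / (2j+1)‼`, `j ≤ N`. -/
def oddCoeffs : ℕ → List ℕ
  | 0 => [1]
  | N + 1 => smul (2 * N + 3) (oddCoeffs N) ++ [1]

theorem length_oddCoeffs (N : ℕ) : (oddCoeffs N).length = N + 1 := by
  induction N with
  | zero => rfl
  | succ N ih => simp [oddCoeffs, length_smul, ih]

theorem oddSeries_eq_eval (N : ℕ) (x : ℝ) :
    oddSeries N x = x * eval (oddCoeffs N) (x ^ 2) / ((2 * N + 1)‼ : ℝ) := by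
  induction N with
  | zero => simp [oddSeries, oddCoeffs, eval]
  | succ N ih =>
    have := doubleFactorial_cast_pos (2 * N + 1)
    rw [oddSeries_succ, ih, oddCoeffs, eval_append_singleton, eval_smul, length_smul,
      length_oddCoeffs, show 2 * (N + 1) + 1 = 2 * N + 3 by ring,
      doubleFactorial_two_mul_add_three]
    push_cast
    field_simp
    ring

/-- The numerator of `∑ j, p j * (m+1)(m+3)⋯(m+2j-1) / b ^ j` over `b ^ p.length`. -/
def momentNum (b : ℕ) : List ℕ → ℕ → ℕ
  | [], _ => 0
  | c :: p, m => c * b ^ (p.length + 1) + (m + 1) * momentNum b p (m + 2)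

theorem pow_mul_eval_cons (c : ℕ) (p : List ℕ) (a t : ℝ) (m : ℕ) :
    Real.exp (-a * t ^ 2) * (t ^ m * eval (c :: p) (t ^ 2)) =
      c * (t ^ m * Real.exp (-a * t ^ 2)) +
        Real.exp (-a * t ^ 2) * (t ^ (m + 2) * eval p (t ^ 2)) := by
  simp only [eval]
  ring

theorem integrableOn_exp_mul_eval {a : ℝ} (ha : 0 < a) (p : List ℕ) (m : ℕ) :
    IntegrableOn (fun t => Real.exp (-a * t ^ 2) * (t ^ m * eval p (t ^ 2))) (Set.Ioi 0) := by
  induction p generalizing m with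
  | nil => simp [eval]
  | cons c p ih =>
    simp_rw [pow_mul_eval_cons]
    exact ((integrableOn_pow_mul_exp_neg_mul_sq ha m).const_mul _).add (ih _)

/-- Repeated use of `gaussMoment_add_two` reduces every moment to `gaussMoment a m`. Taking `2a` to
be a natural number `b` lets all denominators be cleared, so the result is computable in `ℕ`. -/
theorem integral_exp_mul_eval {a : ℝ} (ha : 0 < a) {b : ℕ} (hb : (b : ℝ) = 2 * a)
    (p : List ℕ) (m : ℕ) :
    ∫ t in Set.Ioi (0 : ℝ), Real.exp (-a * t ^ 2) * (t ^ m * eval p (t ^ 2)) =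
      gaussMoment a m * (momentNum b p m / (b : ℝ) ^ p.length) := by
  induction p generalizing m with
  | nil => simp [eval, momentNum]
  | cons c p ih =>
    simp_rw [pow_mul_eval_cons]
    rw [integral_add ((integrableOn_pow_mul_exp_neg_mul_sq ha m).const_mul _)
      (integrableOn_exp_mul_eval ha p _), integral_const_mul, ih, gaussMoment_add_two ha,
      ← gaussMoment, momentNum, List.length_cons]
    have hb0 : (b : ℝ) ≠ 0 := by rw [hb]; positivity
    rw [← hb]
    push_cast
    field_simp
    ring

/-- Powers of a coefficient list. -/
def pow (p : List ℕ) : ℕ → List ℕ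
  | 0 => [1]
  | k + 1 => mul p (pow p k)

theorem eval_pow (p : List ℕ) (k : ℕ) (y : ℝ) : eval (pow p k) y = eval p y ^ k := by
  induction k with
  | zero => simp [pow, eval]
  | succ k ih => rw [pow, eval_mul, ih, pow_succ']

theorem integral_exp_mul_oddSeries_pow (N k : ℕ) :
    ∫ t in Set.Ioi (0 : ℝ), Real.exp (-(k + 1) * t ^ 2) * oddSeries N t ^ (2 * k) =
      gaussMoment (k + 1) (2 * k) *
        (momentNum (2 * k + 2) (pow (oddCoeffs N) (2 * k)) (2 * k) /
          ((2 * k + 2 : ℕ) : ℝ) ^ (pow (oddCoeffs N) (2 * k)).length) /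
        ((2 * N + 1)‼ : ℝ) ^ (2 * k) := by
  rw [← integral_exp_mul_eval (by positivity) (by push_cast; ring), ← integral_div]
  congr 1
  ext t
  rw [oddSeries_eq_eval, eval_pow, div_pow, mul_pow]
  ring

end NatPoly

/-! ### Numerical enclosures of the moments. -/

theorem gaussMoment_one_odd (m : ℕ) : gaussMoment 1 (2 * m + 1) = (m ! : ℝ) / 2 := by
  induction m with
  | zero => simp [gaussMoment_one]
  | succ m ih =>
    rw [show 2 * (m + 1) + 1 = 2 * m + 1 + 2 by ring, gaussMoment_add_two one_pos, ih,
      Nat.factorial_succ]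
    push_cast
    field_simp
    ring

/-- The moment `E[(Φ(Y) - 1/2) ^ (2k)]` of a centred normal variable `Y` of variance `1/2`. -/
noncomputable def normalHalfMean (k : ℕ) : ℝ := normalHalfMoment k * (2 / √Real.pi)

/-- The rational factor of the integral of `exp (-(k+1)t²) * oddSeries N t ^ (2k)`. -/
noncomputable def seriesFactor (N k : ℕ) : ℝ :=
  (NatPoly.momentNum (2 * k + 2) (NatPoly.pow (NatPoly.oddCoeffs N) (2 * k)) (2 * k) : ℝ) /
    (((2 * k + 2 : ℕ) : ℝ) ^ (NatPoly.pow (NatPoly.oddCoeffs N) (2 * k)).length *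
      ((2 * N + 1)‼ : ℝ) ^ (2 * k))

theorem integral_eq_seriesFactor (N k : ℕ) :
    ∫ t in Set.Ioi (0 : ℝ), Real.exp (-(k + 1) * t ^ 2) * oddSeries N t ^ (2 * k) =
      gaussMoment (k + 1) (2 * k) * seriesFactor N k := by
  rw [NatPoly.integral_exp_mul_oddSeries_pow, seriesFactor]
  field_simp

theorem le_normalHalfMean (N k : ℕ) :
    ((2 * Real.pi) ^ k)⁻¹ * (gaussMoment (k + 1) (2 * k) * (2 / √Real.pi)) * seriesFactor N k ≤
      normalHalfMean k := by
  have h := le_normalHalfMoment N k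
  rw [integral_eq_seriesFactor] at h
  have h2 := mul_le_mul_of_nonneg_right h (show 0 ≤ 2 / √Real.pi by positivity)
  refine le_trans (le_of_eq ?_) h2
  ring

theorem normalHalfMean_le (N k : ℕ) :
    normalHalfMean k ≤
      ((2 * Real.pi) ^ k)⁻¹ * (gaussMoment (k + 1) (2 * k) * (2 / √Real.pi)) * seriesFactor N k +
      (2 * k) * (1 / 2) ^ (2 * k - 1) *
        (((N + 1)! : ℝ) / ((2 * N + 3)‼ : ℝ) / (√2 * Real.pi)) := by
  have h := normalHalfMoment_le N k
  rw [integral_eq_seriesFactor, show 2 * N + 3 = 2 * (N + 1) + 1 by ring,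
    gaussMoment_one_odd] at h
  have h2 := mul_le_mul_of_nonneg_right h (show 0 ≤ 2 / √Real.pi by positivity)
  refine h2.trans (le_of_eq ?_)
  have hπ : √(2 * Real.pi) = √2 * √Real.pi := Real.sqrt_mul (by norm_num) _
  have hπ2 : Real.pi = √Real.pi * √Real.pi := (Real.mul_self_sqrt Real.pi_pos.le).symm
  have h0 : 0 < √Real.pi := Real.sqrt_pos.2 Real.pi_pos
  rw [hπ, show 2 * (N + 1) + 1 = 2 * N + 3 by ring]
  have e : (√2 * √Real.pi)⁻¹ * (2 / √Real.pi) = 2 / (√2 * Real.pi) := by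
    rw [div_eq_mul_inv 2 (√2 * Real.pi)]
    nth_rw 3 [hπ2]
    field_simp
  linear_combination (2 * k) * (1 / 2) ^ (2 * k - 1) * (((N + 1)! : ℝ) /
    ((2 * N + 3)‼ : ℝ)) / 2 * e

theorem le_seriesFactor {N k a c : ℕ} (hc : 0 < c)
    (h : a * ((2 * k + 2) ^ (NatPoly.pow (NatPoly.oddCoeffs N) (2 * k)).length *
      (2 * N + 1)‼ ^ (2 * k)) ≤
      c * NatPoly.momentNum (2 * k + 2) (NatPoly.pow (NatPoly.oddCoeffs N) (2 * k)) (2 * k)) :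
    (a : ℝ) / c ≤ seriesFactor N k := by
  have := doubleFactorial_cast_pos (2 * N + 1)
  rw [seriesFactor, div_le_div_iff₀ (by exact_mod_cast hc) (by positivity)]
  rw [mul_comm (Nat.cast (NatPoly.momentNum _ _ _))]
  exact_mod_cast h

theorem seriesFactor_le {N k a c : ℕ} (hc : 0 < c)
    (h : c * NatPoly.momentNum (2 * k + 2) (NatPoly.pow (NatPoly.oddCoeffs N) (2 * k)) (2 * k) ≤
      a * ((2 * k + 2) ^ (NatPoly.pow (NatPoly.oddCoeffs N) (2 * k)).length *
      (2 * N + 1)‼ ^ (2 * k))) :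
    seriesFactor N k ≤ (a : ℝ) / c := by
  have := doubleFactorial_cast_pos (2 * N + 1)
  rw [seriesFactor, div_le_div_iff₀ (by positivity) (by exact_mod_cast hc)]
  rw [mul_comm (Nat.cast (NatPoly.momentNum _ _ _))]
  exact_mod_cast h

/-- With denominators cleared, each bound is an inequality between explicit natural numbers, which
the kernel evaluates. -/
theorem seriesFactor_one_bounds :
    1.92240786 ≤ seriesFactor 20 1 ∧ seriesFactor 20 1 ≤ 1.92240787 := by
  constructor
  · exact le_trans (by norm_num)
      (le_seriesFactor (N := 20) (k := 1) (a := 192240786) (c := 10 ^ 8) (by norm_num)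
        (by decide +kernel))
  · exact le_trans (seriesFactor_le (N := 20) (k := 1) (a := 192240787) (c := 10 ^ 8)
      (by norm_num) (by decide +kernel)) (by norm_num)

theorem seriesFactor_two_bounds :
    5.01152435 ≤ seriesFactor 20 2 ∧ seriesFactor 20 2 ≤ 5.01152436 := by
  constructor
  · exact le_trans (by norm_num)
      (le_seriesFactor (N := 20) (k := 2) (a := 501152435) (c := 10 ^ 8) (by norm_num)
        (by decide +kernel))
  · exact le_trans (seriesFactor_le (N := 20) (k := 2) (a := 501152436) (c := 10 ^ 8)
      (by norm_num) (by decide +kernel)) (by norm_num)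

theorem seriesFactor_three_bounds :
    14.93468209 ≤ seriesFactor 20 3 ∧ seriesFactor 20 3 ≤ 14.93468211 := by
  constructor
  · exact le_trans (by norm_num)
      (le_seriesFactor (N := 20) (k := 3) (a := 1493468209) (c := 10 ^ 8) (by norm_num)
        (by decide +kernel))
  · exact le_trans (seriesFactor_le (N := 20) (k := 3) (a := 1493468211) (c := 10 ^ 8)
      (by norm_num) (by decide +kernel)) (by norm_num)

theorem sqrt_two_bounds : 1.41421356 ≤ √2 ∧ √2 ≤ 1.41421357 :=
  ⟨Real.le_sqrt_of_sq_le (by norm_num), Real.sqrt_le_iff.2 (by norm_num)⟩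

theorem sqrt_three_bounds : 1.7320508 ≤ √3 ∧ √3 ≤ 1.7320509 :=
  ⟨Real.le_sqrt_of_sq_le (by norm_num), Real.sqrt_le_iff.2 (by norm_num)⟩

theorem pi_bounds : 3.141592653 ≤ Real.pi ∧ Real.pi ≤ 3.141592654 :=
  ⟨le_trans (by norm_num) Real.pi_gt_d20.le, le_trans Real.pi_lt_d20.le (by norm_num)⟩

/-- The ratio `(N+1)! / (2N+3)‼` decays roughly like `2^(-N)`; `N = 20` is enough for the precision
required. -/
theorem remainder_bound :
    ((20 + 1)! : ℝ) / ((2 * 20 + 3)‼ : ℝ) / (√2 * Real.pi) ≤ 2.1e-8 := by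
  have h1 := sqrt_two_bounds.1
  have h2 := pi_bounds.1
  have h3 : (4.44 : ℝ) ≤ √2 * Real.pi := by
    calc (4.44 : ℝ) ≤ 1.41421356 * 3.141592653 := by norm_num
      _ ≤ _ := by gcongr
  rw [div_le_iff₀ (by positivity)]
  refine le_trans ?_ (mul_le_mul_of_nonneg_left h3 (by norm_num))
  norm_num [Nat.factorial, Nat.doubleFactorial]

theorem normalHalfMean_one_bounds :
    0.05408672 ≤ normalHalfMean 1 ∧ normalHalfMean 1 ≤ 0.05408675 := by
  have h1 := le_normalHalfMean 20 1
  have h2 := normalHalfMean_le 20 1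
  have hg : ((2 * Real.pi) ^ 1)⁻¹ * (gaussMoment ((1 : ℕ) + 1) (2 * 1) * (2 / √Real.pi)) =
      1 / (8 * (Real.pi * √2)) := by
    rw [show 2 * 1 = 0 + 2 by norm_num, gaussMoment_add_two (by norm_num),
      gaussMoment_zero (by norm_num)]
    have h0 : 0 < √Real.pi := Real.sqrt_pos.2 Real.pi_pos
    norm_num
    field_simp
    norm_num
  rw [hg] at h1 h2
  obtain ⟨s1, s2⟩ := seriesFactor_one_bounds
  obtain ⟨p1, p2⟩ := pi_bounds
  obtain ⟨q1, q2⟩ := sqrt_two_bounds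
  have hr := remainder_bound
  have hl : 1 / (8 * (3.141592654 * 1.41421357)) ≤ 1 / (8 * (Real.pi * √2)) := by gcongr
  have hu : 1 / (8 * (Real.pi * √2)) ≤ 1 / (8 * (3.141592653 * 1.41421356)) := by gcongr
  have hl' := mul_le_mul hl s1 (by norm_num) (by positivity)
  have hu' := mul_le_mul hu s2 (by linarith) (by norm_num)
  generalize 1 / (8 * (Real.pi * √2)) * seriesFactor 20 1 = X at h1 h2 hl' hu'
  generalize ((20 + 1)! : ℝ) / ((2 * 20 + 3)‼ : ℝ) / (√2 * Real.pi) = R at h2 hr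
  norm_num at hl' hu' h2 hr ⊢
  constructor <;> linarith

theorem normalHalfMean_two_bounds :
    0.00610756 ≤ normalHalfMean 2 ∧ normalHalfMean 2 ≤ 0.00610758 := by
  have h1 := le_normalHalfMean 20 2
  have h2 := normalHalfMean_le 20 2
  have hg : ((2 * Real.pi) ^ 2)⁻¹ * (gaussMoment ((2 : ℕ) + 1) (2 * 2) * (2 / √Real.pi)) =
      1 / (48 * (Real.pi ^ 2 * √3)) := by
    rw [show 2 * 2 = 0 + 2 + 2 by norm_num, gaussMoment_add_two (by norm_num),
      gaussMoment_add_two (by norm_num), gaussMoment_zero (by norm_num)]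
    have h0 : 0 < √Real.pi := Real.sqrt_pos.2 Real.pi_pos
    norm_num
    field_simp
    norm_num
  rw [hg] at h1 h2
  obtain ⟨s1, s2⟩ := seriesFactor_two_bounds
  obtain ⟨p1, p2⟩ := pi_bounds
  obtain ⟨q1, q2⟩ := sqrt_three_bounds
  have hr := remainder_bound
  have hl : 1 / (48 * (3.141592654 ^ 2 * 1.7320509)) ≤ 1 / (48 * (Real.pi ^ 2 * √3)) := by gcongr
  have hu : 1 / (48 * (Real.pi ^ 2 * √3)) ≤ 1 / (48 * (3.141592653 ^ 2 * 1.7320508)) := by gcongr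
  have hl' := mul_le_mul hl s1 (by norm_num) (by positivity)
  have hu' := mul_le_mul hu s2 (by linarith) (by norm_num)
  generalize 1 / (48 * (Real.pi ^ 2 * √3)) * seriesFactor 20 2 = X at h1 h2 hl' hu'
  generalize ((20 + 1)! : ℝ) / ((2 * 20 + 3)‼ : ℝ) / (√2 * Real.pi) = R at h2 hr
  norm_num at hl' hu' h2 hr ⊢
  constructor <;> linarith

theorem normalHalfMean_three_bounds :
    0.00088195 ≤ normalHalfMean 3 ∧ normalHalfMean 3 ≤ 0.000881962 := by
  have h1 := le_normalHalfMean 20 3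
  have h2 := normalHalfMean_le 20 3
  have hg : ((2 * Real.pi) ^ 3)⁻¹ * (gaussMoment ((3 : ℕ) + 1) (2 * 3) * (2 / √Real.pi)) =
      15 / (8192 * Real.pi ^ 3) := by
    rw [show 2 * 3 = 0 + 2 + 2 + 2 by norm_num, gaussMoment_add_two (by norm_num),
      gaussMoment_add_two (by norm_num), gaussMoment_add_two (by norm_num),
      gaussMoment_zero (by norm_num)]
    have h0 : 0 < √Real.pi := Real.sqrt_pos.2 Real.pi_pos
    have h4 : √(((3 : ℕ) : ℝ) + 1) = 2 := by
      rw [show (((3 : ℕ) : ℝ) + 1) = 2 ^ 2 by norm_num]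
      exact Real.sqrt_sq (by norm_num)
    rw [h4]
    norm_num
    field_simp
    norm_num
  rw [hg] at h1 h2
  obtain ⟨s1, s2⟩ := seriesFactor_three_bounds
  obtain ⟨p1, p2⟩ := pi_bounds
  have hr := remainder_bound
  have hl : 15 / (8192 * 3.141592654 ^ 3) ≤ 15 / (8192 * Real.pi ^ 3) := by gcongr
  have hu : 15 / (8192 * Real.pi ^ 3) ≤ 15 / (8192 * 3.141592653 ^ 3) := by gcongr
  have hl' := mul_le_mul hl s1 (by norm_num) (by positivity)
  have hu' := mul_le_mul hu s2 (by linarith) (by norm_num)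
  generalize 15 / (8192 * Real.pi ^ 3) * seriesFactor 20 3 = X at h1 h2 hl' hu'
  generalize ((20 + 1)! : ℝ) / ((2 * 20 + 3)‼ : ℝ) / (√2 * Real.pi) = R at h2 hr
  norm_num at hl' hu' h2 hr ⊢
  constructor <;> linarith

/-! ### Mean widths in dimensions five to eight. -/

theorem supportFn_smul {n : ℕ} (K : Set (EuclideanSpace ℝ (Fin n))) {r : ℝ} (hr : 0 < r)
    (x : EuclideanSpace ℝ (Fin n)) : supportFn K (r • x) = r * supportFn K x := by
  rw [supportFn, supportFn, ← smul_eq_mul, ← Real.sSup_smul_of_nonneg hr.le]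
  congr 1
  ext z
  simp [Set.mem_smul_set, inner_smul_left]

/-- `hc` records the cancellation of odd powers; the `c`'s are half the even coefficients. With `m +
2` vertices in dimension `m + 1`, degree six covers dimensions up to eight. -/
theorem meanWidth_unitRegularSimplex {m : ℕ} {T : Set (EuclideanSpace ℝ (Fin (m + 1)))}
    (hT : IsUnitRegularSimplex T) {c₀ c₁ c₂ c₃ : ℝ}
    (hc : ∀ x : ℝ, (1 / 2 + x) ^ m + (1 / 2 - x) ^ m =
      2 * (c₀ + c₁ * x ^ 2 + c₂ * x ^ 4 + c₃ * x ^ 6)) :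
    meanWidth T * gaussMoment (1 / 2) (m + 1) =
      (m + 2) * (m + 1) / (2 * √2 * √Real.pi) *
        (c₀ + c₁ * normalHalfMean 1 + c₂ * normalHalfMean 2 + c₃ * normalHalfMean 3) *
        gaussMoment (1 / 2) m := by
  obtain ⟨s, hs, rfl⟩ := hT
  rw [← integral_supportFn_stdGaussian (Nat.succ_ne_zero m) _ fun r hr x => supportFn_smul _ hr x]
  simp_rw [supportFn_convexHull_range]
  rw [integral_iSup_inner_of_dist_eq_one hs, integral_iSup_pi_gaussianReal, Fintype.card_fin,
    integral_one_sub_normal_pow]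
  simp_rw [hc, mul_left_comm (Real.exp _) 2]
  rw [integral_const_mul, integral_exp_mul_even_poly, Nat.succ_sub_one]
  simp only [normalHalfMean]
  have h0 : 0 < √Real.pi := Real.sqrt_pos.2 Real.pi_pos
  have hπ : Real.pi = √Real.pi ^ 2 := (Real.sq_sqrt Real.pi_pos.le).symm
  rw [show (2 * Real.pi)⁻¹ = (2 * √Real.pi ^ 2)⁻¹ by rw [← hπ]]
  field_simp

theorem sqrt_half_mul_sqrt_two : √(1 / 2) * √2 = 1 := by
  rw [← Real.sqrt_mul (by norm_num)]
  norm_num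

theorem gaussMoment_half_zero : gaussMoment (1 / 2) 0 = √Real.pi * √2 / 2 := by
  have h2 : 0 < √(1 / 2 : ℝ) := by positivity
  rw [gaussMoment_zero (by norm_num)]
  field_simp
  linear_combination -sqrt_half_mul_sqrt_two

theorem gaussMoment_half_one : gaussMoment (1 / 2) 1 = 1 := by
  rw [gaussMoment_one (by norm_num)]
  norm_num

theorem gaussMoment_half_add_two (m : ℕ) :
    gaussMoment (1 / 2) (m + 2) = (m + 1) * gaussMoment (1 / 2) m := by
  rw [gaussMoment_add_two (by norm_num)]
  norm_num

/-- Even half-line moments carry `√(2π)` and odd ones are rational. The prefactor therefore becomes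
rational in odd dimensions and a rational multiple of `1/π` in even ones. -/
theorem meanWidth_five {T : Set (EuclideanSpace ℝ (Fin 5))} (hT : IsUnitRegularSimplex T) :
    meanWidth T = 45 / 16 * (1 / 16 + 3 / 2 * normalHalfMean 1 + normalHalfMean 2) := by
  have h := meanWidth_unitRegularSimplex hT (c₀ := 1 / 16) (c₁ := 3 / 2) (c₂ := 1) (c₃ := 0)
    (fun x => by ring)
  have hπ : 0 < √Real.pi := Real.sqrt_pos.2 Real.pi_pos
  simp only [gaussMoment_half_add_two, gaussMoment_half_zero, gaussMoment_half_one,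
    show 4 + 1 = 3 + 2 by rfl, show 3 = 1 + 2 by rfl, show 4 = 0 + 2 + 2 by rfl] at h
  push_cast at h
  field_simp at h
  linarith

theorem meanWidth_six {T : Set (EuclideanSpace ℝ (Fin 6))} (hT : IsUnitRegularSimplex T) :
    meanWidth T = 56 / 5 / Real.pi *
      (1 / 32 + 5 / 4 * normalHalfMean 1 + 5 / 2 * normalHalfMean 2) := by
  have h := meanWidth_unitRegularSimplex hT (c₀ := 1 / 32) (c₁ := 5 / 4) (c₂ := 5 / 2) (c₃ := 0)
    (fun x => by ring)
  have hπ : 0 < √Real.pi := Real.sqrt_pos.2 Real.pi_pos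
  simp only [gaussMoment_half_add_two, gaussMoment_half_zero, gaussMoment_half_one,
    show 5 + 1 = 4 + 2 by rfl, show 4 = 0 + 2 + 2 by rfl, show 5 = 1 + 2 + 2 by rfl] at h
  push_cast at h
  field_simp at h
  rw [Real.sq_sqrt (show (0 : ℝ) ≤ 2 by norm_num)] at h
  rw [show Real.pi = √Real.pi ^ 2 from (Real.sq_sqrt Real.pi_pos.le).symm]
  field_simp
  linarith

theorem meanWidth_seven {T : Set (EuclideanSpace ℝ (Fin 7))} (hT : IsUnitRegularSimplex T) :
    meanWidth T = 35 / 8 * (1 / 64 + 15 / 16 * normalHalfMean 1 + 15 / 4 * normalHalfMean 2 +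
      normalHalfMean 3) := by
  have h := meanWidth_unitRegularSimplex hT (c₀ := 1 / 64) (c₁ := 15 / 16) (c₂ := 15 / 4)
    (c₃ := 1) (fun x => by ring)
  have hπ : 0 < √Real.pi := Real.sqrt_pos.2 Real.pi_pos
  simp only [gaussMoment_half_add_two, gaussMoment_half_zero, gaussMoment_half_one,
    show 6 + 1 = 5 + 2 by rfl, show 5 = 1 + 2 + 2 by rfl, show 6 = 0 + 2 + 2 + 2 by rfl] at h
  push_cast at h
  field_simp at h
  linarith

theorem meanWidth_eight {T : Set (EuclideanSpace ℝ (Fin 8))} (hT : IsUnitRegularSimplex T) :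
    meanWidth T = 576 / 35 / Real.pi * (1 / 128 + 21 / 32 * normalHalfMean 1 +
      35 / 8 * normalHalfMean 2 + 7 / 2 * normalHalfMean 3) := by
  have h := meanWidth_unitRegularSimplex hT (c₀ := 1 / 128) (c₁ := 21 / 32) (c₂ := 35 / 8)
    (c₃ := 7 / 2) (fun x => by ring)
  have hπ : 0 < √Real.pi := Real.sqrt_pos.2 Real.pi_pos
  simp only [gaussMoment_half_add_two, gaussMoment_half_zero, gaussMoment_half_one,
    show 7 + 1 = 6 + 2 by rfl, show 6 = 0 + 2 + 2 + 2 by rfl, show 7 = 1 + 2 + 2 + 2 by rfl] at h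
  push_cast at h
  field_simp at h
  rw [Real.sq_sqrt (show (0 : ℝ) ≤ 2 by norm_num)] at h
  rw [show Real.pi = √Real.pi ^ 2 from (Real.sq_sqrt Real.pi_pos.le).symm]
  field_simp
  linarith

theorem mainTheorem4 :
    (∀ T : Set (EuclideanSpace ℝ (Fin 5)), IsUnitRegularSimplex T →
      (0.4208 : ℝ) ≤ meanWidth T ∧ meanWidth T ≤ (0.4215 : ℝ)) ∧
    (∀ T : Set (EuclideanSpace ℝ (Fin 6)), IsUnitRegularSimplex T →
      (0.4067 : ℝ) ≤ meanWidth T ∧ meanWidth T ≤ (0.407 : ℝ)) ∧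
    (∀ T : Set (EuclideanSpace ℝ (Fin 7)), IsUnitRegularSimplex T →
      (0.39425 : ℝ) ≤ meanWidth T ∧ meanWidth T ≤ (0.39427 : ℝ)) ∧
    (∀ T : Set (EuclideanSpace ℝ (Fin 8)), IsUnitRegularSimplex T →
      (0.383 : ℝ) ≤ meanWidth T ∧ meanWidth T ≤ (0.38301 : ℝ)) := by
  obtain ⟨a1, b1⟩ := normalHalfMean_one_bounds
  obtain ⟨a2, b2⟩ := normalHalfMean_two_bounds
  obtain ⟨a3, b3⟩ := normalHalfMean_three_bounds
  obtain ⟨p1, p2⟩ := pi_bounds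
  refine ⟨fun T hT => ?_, fun T hT => ?_, fun T hT => ?_, fun T hT => ?_⟩
  · rw [meanWidth_five hT]
    constructor <;> linarith
  -- Multiplying out `π` makes the inequalities linear in `π` and the moments.
  · rw [meanWidth_six hT, div_mul_eq_mul_div, le_div_iff₀ Real.pi_pos, div_le_iff₀ Real.pi_pos]
    constructor <;> linarith
  · rw [meanWidth_seven hT]
    constructor <;> linarith
  · rw [meanWidth_eight hT, div_mul_eq_mul_div, le_div_iff₀ Real.pi_pos, div_le_iff₀ Real.pi_pos]
    constructor <;> linarith
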